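/- Let $A$ be a finite set, $F(A)$ the free group on $A$ and $\widehat F(A)$ the free profinite group on $A$ (the profinite completion of $F(A)$). For an endomorphism $\varphi$ of $F(A)$ let $\widehat\varphi$ be its unique continuous extension to $\widehat F(A)$, and let $\widehat\varphi^{\,\omega}$ be the unique idempotent in the closure of $\{\widehat\varphi^{\,n} : n\ge 1\}$ in the monoid of continuous endomorphisms of $\widehat F(A)$ with the compact-open topology. For a set $R\subseteq\widehat F(B)$ write $\langle B\mid R\rangle$ for the quotient of $\widehat F(B)$ by the closed normal subgroup generated by $R$, and for a profinite group $G$ let $d(G)$ be the least number $|B|$ of generators in a presentation $G\cong\langle B\mid R\rangle$ (isomorphism of topological groups). We say that $\varphi$ defines a minimal $\omega$-presentation of $G$ if $$G\cong\langle A\mid \widehat\varphi^{\,\omega}(a)a^{-1},\ a\in A\rangle \quad\text{and}\quad |A|=d(G).$$ **Proposition 4.2.** If $\varphi\in\mathrm{End}(F(A))$ defines a minimal $\omega$-presentation of a profinite group $G$, then $G$ is a free profinite group if and only if $\varphi$ is an automorphism of $F(A)$. (Here $G$ is a free profinite group if it has a subset $X$ converging to $1$, i.e. all but finitely many elements of $X$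 lie in any given open subgroup, such that every map from $X$ to a profinite group $H$ converging to $1$, i.e. sending all but finitely many elements of $X$ into any given open subgroup of $H$, extends uniquely to a continuous homomorphism $G\to H$.) -/

import Mathlib

universe u

namespace OmegaPresentation

/-- The free profinite group `F̂(A)` on a finite set `A`: the profinite completion of the
free group on `A`. (Used only for finite `A`.) -/
noncomputable abbrev FreePro (A : Type u) : ProfiniteGrp.{u} :=
  ProfiniteGrp.profiniteCompletion.obj (GrpCat.of (FreeGroup A))

/-- The letter `a`, seen as an element of `F̂(A)`. -/
noncomputable def letter {A : Type u} (a : A) : FreePro A :=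
  ProfiniteGrp.ProfiniteCompletion.etaFn (GrpCat.of (FreeGroup A)) (FreeGroup.of a)

/-- The profinite extension of an endomorphism of the free group on `A`: the continuous
endomorphism of `F̂(A)` that it induces by functoriality of the profinite completion. -/
noncomputable def proExt {A : Type u} (φ : FreeGroup A →* FreeGroup A) :
    FreePro A →ₜ* FreePro A :=
  (ProfiniteGrp.profiniteCompletion.map (GrpCat.ofHom φ)).hom

/-- `e` is the `ω`-power of the continuous endomorphism `ψ`: it is an idempotent in the closure of
`{ψ ^ n | n ≥ 1}`, where the continuous endomorphisms carry the compact-open topology. For a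
finitely generated profinite group there is exactly one such `e`. The exponent `0` has to be left
out, since `ψ ^ 0` is the identity, which is always idempotent. -/
def IsOmegaPower {P : ProfiniteGrp.{u}} (ψ e : P →ₜ* P) : Prop :=
  e ∈ closure {f : P →ₜ* P | ∃ n : ℕ, 1 ≤ n ∧ ⇑f = (⇑ψ)^[n]} ∧ e.comp e = e

/-- The closed normal subgroup generated by a set `R`. -/
def closedNormalClosure {P : ProfiniteGrp.{u}} (R : Set P) : Subgroup P :=
  (Subgroup.normalClosure R).topologicalClosure

instance {P : ProfiniteGrp.{u}} (R : Set P) : (closedNormalClosure R).Normal :=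
  Subgroup.is_normal_topologicalClosure _

/-- `G ≅ ⟨A ∣ R⟩`: the profinite group `G` is isomorphic, as a topological group, to the quotient
of `F̂(A)` by the closed normal subgroup generated by `R`. -/
def IsPresentation (G : ProfiniteGrp.{u}) (A : Type u) (R : Set (FreePro A)) : Prop :=
  Nonempty (G ≃ₜ* (FreePro A ⧸ closedNormalClosure R))

/-- `d(G)`: the least number of generators in a presentation of `G`
(`⊤` if `G` has no presentation with finitely many generators). -/
noncomputable def minGenerators (G : ProfiniteGrp.{u}) : ℕ∞ :=
  ⨅ (B : Type u) (_ : Finite B) (R : Set (FreePro B)) (_ : IsPresentation G B R), (Nat.card B : ℕ∞)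

/-- `φ` defines an `ω`-presentation of `G`: `G ≅ ⟨A ∣ φ̂^ω(a) a⁻¹, a ∈ A⟩`. -/
def DefinesOmegaPresentation {A : Type u} (φ : FreeGroup A →* FreeGroup A)
    (G : ProfiniteGrp.{u}) : Prop :=
  ∃ e : FreePro A →ₜ* FreePro A, IsOmegaPower (proExt φ) e ∧
    IsPresentation G A (Set.range fun a : A => e (letter a) * (letter a)⁻¹)

/-- `φ` defines a minimal `ω`-presentation of `G`: moreover the number of generators is `d(G)`. -/
def DefinesMinimalOmegaPresentation {A : Type u} (φ : FreeGroup A →* FreeGroup A)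
    (G : ProfiniteGrp.{u}) : Prop :=
  DefinesOmegaPresentation φ G ∧ (Nat.card A : ℕ∞) = minGenerators G

/-- `f : X → H` converges to `1`: every open subgroup contains all but finitely many values. -/
def ConvergesToOne {X : Type u} {H : ProfiniteGrp.{u}} (f : X → H) : Prop :=
  ∀ U : OpenSubgroup H, {x : X | f x ∉ U}.Finite

/-- `X ⊆ G` is a basis of `G` as a free profinite group: `X` converges to `1`, and every map
converging to `1` from `X` to a profinite group extends uniquely to a continuous homomorphism. -/
def IsFreeProfiniteBasis (G : ProfiniteGrp.{u}) (X : Set G) : Prop :=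
  ConvergesToOne (fun x : X => (x : G)) ∧
    ∀ (H : ProfiniteGrp.{u}) (f : X → H), ConvergesToOne f →
      ∃! F : G →ₜ* H, ∀ x : X, F x = f x

/-- `G` is a free profinite group (of arbitrary rank). -/
def IsFreeProfinite (G : ProfiniteGrp.{u}) : Prop :=
  ∃ X : Set G, IsFreeProfiniteBasis G X

end OmegaPresentation

namespace OmegaPresentation

/-! Both conditions are equivalent to `φ̂^ω = id`. The link is `IsOmegaPower.exists_iterate`: on
homomorphisms to one finite group, `φ̂^ω` acts as a positive power of `φ̂`. If `G` is free, counting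
homomorphisms to `ℤ/2` and minimality of `|A|` give a basis of exactly `|A|` elements. By the Hopf
property `F̂(A) → G` is injective, so the relators are trivial and `φ̂^ω = id`. Every homomorphism
from `F(A)` to a finite group is then fixed by some power of `φ`; residual finiteness makes `φ`
injective and Marshall Hall's theorem makes it surjective. Conversely, for bijective `φ`,
precomposition with `φ̂^ω` is injective and idempotent on homomorphisms to finite groups. So `φ̂^ω =
id`, the relators vanish and `G ≅ F̂(A)`. -/

variable {A : Type u}

/-! ### Subgroup separability of free groups -/

/-- The restrictions of the generators of a free group to a finite subset of a set it acts on
complete to permutations. -/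
theorem exists_hom_perm_of_mulAction {X : Type*} [MulAction (FreeGroup A) X] (V : Finset X) :
    ∃ h : FreeGroup A →* Equiv.Perm V, ∀ (a : A) (v : V),
      FreeGroup.of a • (v : X) ∈ V → (h (FreeGroup.of a) v : X) = FreeGroup.of a • (v : X) := by
  classical
  have key : ∀ a : A, ∃ σ : Equiv.Perm V, ∀ v : V,
      FreeGroup.of a • (v : X) ∈ V → (σ v : X) = FreeGroup.of a • (v : X) := by
    intro a
    -- A partial bijection of the finite set `V` always extends to a permutation.
    let e : {v : V // FreeGroup.of a • (v : X) ∈ V} ≃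
        {v : V // (FreeGroup.of a)⁻¹ • (v : X) ∈ V} :=
      { toFun := fun v => ⟨⟨FreeGroup.of a • ((v : V) : X), v.2⟩, by simp⟩
        invFun := fun v => ⟨⟨(FreeGroup.of a)⁻¹ • ((v : V) : X), v.2⟩, by simp⟩
        left_inv := fun v => by simp
        right_inv := fun v => by simp }
    refine ⟨e.extendSubtype, fun v hv => ?_⟩
    rw [e.extendSubtype_apply_of_mem v hv]
    rfl
  choose σ hσ using key
  exact ⟨FreeGroup.lift σ, fun a v hv => by simpa using hσ a v hv⟩

/-- The rightmost letter acts first, so the points visited on the way are the images of `v` under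
the suffixes of the word. -/
theorem perm_word_apply_eq_smul {X : Type*} [MulAction (FreeGroup A) X] {V : Finset X}
    {h : FreeGroup A →* Equiv.Perm V}
    (hh : ∀ (a : A) (v : V),
      FreeGroup.of a • (v : X) ∈ V → (h (FreeGroup.of a) v : X) = FreeGroup.of a • (v : X))
    (v : V) (L : List (A × Bool)) (hL : ∀ s, s <:+ L → FreeGroup.mk s • (v : X) ∈ V) :
    (h (FreeGroup.mk L) v : X) = FreeGroup.mk L • (v : X) := by
  induction L with
  | nil =>
    have : (FreeGroup.mk [] : FreeGroup A) = 1 := rfl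
    simp [this]
  | cons p L ih =>
    have ih := ih fun s hs => hL s (hs.trans (List.suffix_cons p L))
    have hmem := hL _ (List.suffix_refl (p :: L))
    have hmem' := hL _ (List.suffix_cons p L)
    obtain ⟨a, b⟩ := p
    have hcons : (FreeGroup.mk ((a, b) :: L) : FreeGroup A) =
        FreeGroup.mk [(a, b)] * FreeGroup.mk L := by
      rw [FreeGroup.mul_mk]; rfl
    rw [hcons, mul_smul] at hmem
    rw [hcons, map_mul, mul_smul, Equiv.Perm.mul_apply]
    cases b with
    | true =>
      change FreeGroup.of a • _ ∈ V at hmem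
      change (h (FreeGroup.of a) _ : X) = FreeGroup.of a • _
      rw [hh a _ (by rwa [ih]), ih]
    | false =>
      have hinv : (FreeGroup.mk [(a, false)] : FreeGroup A) = (FreeGroup.of a)⁻¹ := rfl
      rw [hinv] at hmem ⊢
      rw [map_inv]
      -- For an inverse letter, `hh` is applied at the arrival point, which `a` sends back into `V`.
      have := hh a ⟨_, hmem⟩ (by simpa using hmem')
      simp only [smul_inv_smul, ← ih] at this
      rw [← Subtype.ext this]
      simpa using ih

/-- Marshall Hall: finitely generated subgroups of free groups are closed in the profinite
topology. -/
theorem exists_finite_quotient_separating (S : Set (FreeGroup A)) (hS : S.Finite)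
    {w : FreeGroup A} (hw : w ∉ Subgroup.closure S) :
    ∃ (Q : Type u) (_ : Group Q) (_ : Finite Q) (h : FreeGroup A →* Q),
      h w ∉ (Subgroup.closure S).map h := by
  classical
  set H := Subgroup.closure S
  let x₀ : FreeGroup A ⧸ H := ((1 : FreeGroup A) : FreeGroup A ⧸ H)
  have hx₀ : ∀ g : FreeGroup A, g • x₀ = x₀ ↔ g ∈ H := by
    intro g
    change ((g * 1 : FreeGroup A) : FreeGroup A ⧸ H) = ((1 : FreeGroup A) : FreeGroup A ⧸ H) ↔ _
    rw [eq_comm, QuotientGroup.eq]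
    simp
  let orb : FreeGroup A → Finset (FreeGroup A ⧸ H) := fun g =>
    (g.toWord.tails.map fun s => FreeGroup.mk s • x₀).toFinset
  -- `V` holds the whole path of the base coset under `w` and under each generator of `H`; on these
  -- words the permutations imitate the true action, so `H` fixes `x₀` and `w` moves it.
  let V : Finset (FreeGroup A ⧸ H) := (insert w hS.toFinset).biUnion orb
  have hV : ∀ g, g ∈ insert w hS.toFinset → ∀ s, s <:+ g.toWord → FreeGroup.mk s • x₀ ∈ V := by
    intro g hg s hs
    refine Finset.mem_biUnion.2 ⟨g, hg, ?_⟩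
    simp only [orb, List.mem_toFinset, List.mem_map, List.mem_tails]
    exact ⟨s, hs, rfl⟩
  have hx : x₀ ∈ V := by
    have h1 := hV w (Finset.mem_insert_self _ _) [] (List.nil_suffix)
    have : (FreeGroup.mk [] : FreeGroup A) = 1 := rfl
    simpa [this] using h1
  obtain ⟨h, hh⟩ := exists_hom_perm_of_mulAction (A := A) V
  have act : ∀ g, g ∈ insert w hS.toFinset →
      (h g ⟨x₀, hx⟩ : FreeGroup A ⧸ H) = g • x₀ := by
    intro g hg
    have := perm_word_apply_eq_smul hh ⟨x₀, hx⟩ g.toWord (hV g hg)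
    rwa [FreeGroup.mk_toWord] at this
  refine ⟨Equiv.Perm V, inferInstance, inferInstance, h, ?_⟩
  have hle : H.map h ≤ MulAction.stabilizer (Equiv.Perm V) (⟨x₀, hx⟩ : V) := by
    rw [Subgroup.map_le_iff_le_comap]
    refine (Subgroup.closure_le _).2 ?_
    intro g hg
    refine Subtype.ext ?_
    change (h g ⟨x₀, hx⟩ : FreeGroup A ⧸ H) = x₀
    rw [act g (by simp [hg]), hx₀]
    exact Subgroup.subset_closure hg
  intro hmem
  have := hle hmem
  rw [MulAction.mem_stabilizer_iff] at this
  have h2 : (h w ⟨x₀, hx⟩ : FreeGroup A ⧸ H) = x₀ := congrArg Subtype.val this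
  rw [act w (Finset.mem_insert_self _ _), hx₀] at h2
  exact hw h2

/-- Free groups are residually finite. -/
theorem exists_finite_quotient_ne_one {w : FreeGroup A} (hw : w ≠ 1) :
    ∃ (Q : Type u) (_ : Group Q) (_ : Finite Q) (h : FreeGroup A →* Q), h w ≠ 1 := by
  obtain ⟨Q, _, _, h, hh⟩ := exists_finite_quotient_separating ∅ Set.finite_empty
    (w := w) (by simpa using hw)
  exact ⟨Q, _, inferInstance, h, by simpa using hh⟩

/-- An endomorphism of a free group of finite rank whose powers fix every homomorphism to a
finite group (the power depending on the homomorphism) is an automorphism. -/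
theorem bijective_of_forall_finite_quotient [Finite A] (φ : FreeGroup A →* FreeGroup A)
    (hφ : ∀ (Q : Type u) [Group Q] [Finite Q] (h : FreeGroup A →* Q),
      ∃ n : ℕ, 1 ≤ n ∧ ∀ w, h (φ^[n] w) = h w) : Function.Bijective φ := by
  constructor
  · rw [injective_iff_map_eq_one]
    intro w hw
    by_contra hne
    obtain ⟨Q, _, _, h, hh⟩ := exists_finite_quotient_ne_one hne
    obtain ⟨n, hn, hn'⟩ := hφ Q h
    obtain ⟨m, rfl⟩ := Nat.exists_eq_add_of_le' hn
    apply hh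
    rw [← hn', Function.iterate_succ_apply, hw, iterate_map_one, map_one]
  · have hrange : φ.range = Subgroup.closure (Set.range fun a => φ (FreeGroup.of a)) := by
      rw [MonoidHom.range_eq_map, ← FreeGroup.closure_range_of, MonoidHom.map_closure,
        ← Set.range_comp]
      rfl
    intro w
    by_contra hne
    obtain ⟨Q, _, _, h, hh⟩ := exists_finite_quotient_separating
      (Set.range fun a => φ (FreeGroup.of a)) (Set.finite_range _) (w := w)
      (by rw [← hrange]; exact hne)
    obtain ⟨n, hn, hn'⟩ := hφ Q h
    obtain ⟨m, rfl⟩ := Nat.exists_eq_add_of_le' hn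
    apply hh
    -- As `n ≥ 1`, `φ^[n] w` lies in the range of `φ`, and it has the same image under `h` as `w`.
    rw [← hrange, ← hn', Function.iterate_succ_apply']
    exact ⟨_, ⟨_, rfl⟩, rfl⟩

/-! ### Free profinite groups and their finite quotients -/

/-- A finite group with the discrete topology, as a profinite group. -/
def discreteGrp (Q : Type u) [Group Q] [Finite Q] : ProfiniteGrp.{u} :=
  letI : TopologicalSpace Q := ⊥
  letI : DiscreteTopology Q := ⟨rfl⟩
  letI : IsTopologicalGroup Q := {}
  ProfiniteGrp.of Q

/-- The underlying group of `discreteGrp Q` is `Q`. -/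
def discreteGrpEquiv (Q : Type u) [Group Q] [Finite Q] : discreteGrp Q ≃* Q :=
  MulEquiv.refl Q

instance (Q : Type u) [Group Q] [Finite Q] : Finite (discreteGrp Q) :=
  Finite.of_equiv Q (discreteGrpEquiv Q).symm.toEquiv

/-- The canonical homomorphism from the free group to its profinite completion. -/
noncomputable def etaHom (A : Type u) : FreeGroup A →* FreePro A :=
  (ProfiniteGrp.ProfiniteCompletion.eta (GrpCat.of (FreeGroup A))).hom

theorem etaHom_of (a : A) : etaHom A (FreeGroup.of a) = letter a := rfl

theorem denseRange_etaHom : DenseRange (etaHom A) :=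
  ProfiniteGrp.ProfiniteCompletion.denseRange _

theorem FreePro.hom_ext {H : ProfiniteGrp.{u}} {f g : FreePro A →ₜ* H}
    (hfg : ∀ a, f (letter a) = g (letter a)) : f = g := by
  have h1 : f.toMonoidHom.comp (etaHom A) = g.toMonoidHom.comp (etaHom A) :=
    FreeGroup.ext_hom _ _ hfg
  ext x
  exact congrFun (denseRange_etaHom.equalizer f.continuous_toFun g.continuous_toFun
    (funext fun w => DFunLike.congr_fun h1 w)) x

theorem FreePro.exists_extension {H : ProfiniteGrp.{u}} (f : FreeGroup A →* H) :
    ∃ F : FreePro A →ₜ* H, ∀ w, F (etaHom A w) = f w := by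
  refine ⟨(ProfiniteGrp.ProfiniteCompletion.lift (G := GrpCat.of (FreeGroup A)) (P := H)
    (GrpCat.ofHom f)).hom, fun w => ?_⟩
  have := ProfiniteGrp.ProfiniteCompletion.lift_eta (G := GrpCat.of (FreeGroup A)) (P := H)
    (GrpCat.ofHom f)
  exact CategoryTheory.ConcreteCategory.congr_hom this w

theorem FreePro.exists_lift {H : ProfiniteGrp.{u}} (f : A → H) :
    ∃ F : FreePro A →ₜ* H, ∀ a, F (letter a) = f a := by
  obtain ⟨F, hF⟩ := FreePro.exists_extension (FreeGroup.lift f)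
  exact ⟨F, fun a => by rw [← etaHom_of, hF]; simp⟩

theorem proExt_etaHom (φ : FreeGroup A →* FreeGroup A) (w : FreeGroup A) :
    proExt φ (etaHom A w) = etaHom A (φ w) := by
  have := ProfiniteGrp.ProfiniteCompletion.lift_eta (G := GrpCat.of (FreeGroup A))
    (P := FreePro A) (GrpCat.ofHom ((etaHom A).comp φ))
  exact CategoryTheory.ConcreteCategory.congr_hom this w

theorem iterate_proExt_etaHom (φ : FreeGroup A →* FreeGroup A) (n : ℕ) (w : FreeGroup A) :
    (proExt φ)^[n] (etaHom A w) = etaHom A (φ^[n] w) := by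
  induction n generalizing w with
  | zero => rfl
  | succ n ih => rw [Function.iterate_succ_apply, proExt_etaHom, ih, Function.iterate_succ_apply]

instance finite_hom [Finite A] (Q : ProfiniteGrp.{u}) [Finite Q] : Finite (FreePro A →ₜ* Q) :=
  Finite.of_injective (fun f (a : A) => f (letter a))
    fun _ _ h => FreePro.hom_ext fun a => congrFun h a

/-- Profinite groups are residually finite. -/
theorem exists_hom_finite_ne_one {P : ProfiniteGrp.{u}} {x : P} (hx : x ≠ 1) :
    ∃ (Q : ProfiniteGrp.{u}) (_ : Finite Q) (f : P →ₜ* Q), f x ≠ 1 := by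
  obtain ⟨H, hH⟩ := ProfiniteGrp.exist_openNormalSubgroup_sub_open_nhds_of_one
    (G := P) (isOpen_compl_singleton (x := x)) (by simpa using hx.symm)
  have : Finite (P ⧸ H.toSubgroup) := Subgroup.quotient_finite_of_isOpen _ H.isOpen'
  let f : P →* discreteGrp (P ⧸ H.toSubgroup) :=
    (discreteGrpEquiv _).symm.toMonoidHom.comp (QuotientGroup.mk' H.toSubgroup)
  refine ⟨discreteGrp (P ⧸ H.toSubgroup), inferInstance, ⟨f, ?_⟩, ?_⟩
  · refine continuous_of_continuousAt_one f ?_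
    refine (continuousAt_const (y := (1 : discreteGrp (P ⧸ H.toSubgroup)))).congr ?_
    filter_upwards [H.isOpen'.mem_nhds (one_mem H)] with y hy
    have : QuotientGroup.mk' H.toSubgroup y = 1 := (QuotientGroup.eq_one_iff y).2 hy
    exact this.symm
  · intro h
    have : QuotientGroup.mk' H.toSubgroup x = 1 := h
    exact hH (a := x) ((QuotientGroup.eq_one_iff x).1 this) rfl

/-- A map that `Hom(-, Q)` sends to a surjection, for every finite `Q`, is injective. -/
theorem injective_of_forall_exists_comp {P R : ProfiniteGrp.{u}} (f : P →ₜ* R)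
    (hf : ∀ (Q : ProfiniteGrp.{u}) [Finite Q] (h : P →ₜ* Q), ∃ k : R →ₜ* Q, k.comp f = h) :
    Function.Injective f := by
  rw [injective_iff_map_eq_one]
  intro x hx
  by_contra hne
  obtain ⟨Q, _, h, hh⟩ := exists_hom_finite_ne_one hne
  obtain ⟨k, rfl⟩ := hf Q h
  exact hh (by simp [hx])

theorem eq_id_of_forall_comp_eq {P : ProfiniteGrp.{u}} (e : P →ₜ* P)
    (he : ∀ (Q : ProfiniteGrp.{u}) [Finite Q] (h : P →ₜ* Q), h.comp e = h) (x : P) : e x = x := by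
  by_contra hne
  obtain ⟨Q, _, h, hh⟩ := exists_hom_finite_ne_one (x := e x * x⁻¹) (by rwa [ne_eq, mul_inv_eq_one])
  apply hh
  have := DFunLike.congr_fun (he Q h) x
  rw [map_mul, map_inv, mul_inv_eq_one]
  exact this

/-- Finitely generated profinite free groups are Hopfian. -/
theorem FreePro.injective_of_surjective [Finite A] (f : FreePro A →ₜ* FreePro A)
    (hf : Function.Surjective f) : Function.Injective f := by
  refine injective_of_forall_exists_comp f fun Q _ h => ?_
  -- Precomposition with a surjection is an injective self-map of the finite set `Hom(F̂(A), Q)`,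
  -- hence surjective.
  refine Finite.surjective_of_injective (f := fun k : FreePro A →ₜ* Q => k.comp f) ?_ h
  intro k l hkl
  ext x
  obtain ⟨y, rfl⟩ := hf x
  exact DFunLike.congr_fun hkl y

/-! ### The `ω`-power -/

/-- The `ω`-power acts on the homomorphisms to a finite group as some power does. -/
theorem IsOmegaPower.exists_iterate [Finite A] {ψ e : FreePro A →ₜ* FreePro A}
    (he : IsOmegaPower ψ e) (Q : ProfiniteGrp.{u}) [Finite Q] :
    ∃ n : ℕ, 1 ≤ n ∧ ∀ (h : FreePro A →ₜ* Q) (x : FreePro A), h (e x) = h (ψ^[n] x) := by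
  -- A neighbourhood of `e`, open because there are finitely many `h` and finitely many letters.
  let U : Set (FreePro A →ₜ* FreePro A) :=
    ⋂ (h : FreePro A →ₜ* Q), ⋂ (a : A), {f | h (f (letter a)) = h (e (letter a))}
  have hU : IsOpen U := by
    refine isOpen_iInter_of_finite fun h => isOpen_iInter_of_finite fun a => ?_
    have hc : Continuous fun f : FreePro A →ₜ* FreePro A => h (f (letter a)) :=
      h.continuous_toFun.comp (continuous_eval_const (letter a))
    exact (isOpen_discrete {h (e (letter a))}).preimage hc
  obtain ⟨f, hfU, n, hn, hf⟩ := mem_closure_iff.1 he.1 U hU (by simp [U])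
  refine ⟨n, hn, fun h x => ?_⟩
  have : h.comp f = h.comp e := FreePro.hom_ext fun a => by
    have := Set.mem_iInter.1 (Set.mem_iInter.1 hfU h) a
    exact this
  rw [← hf]
  exact (DFunLike.congr_fun this x).symm

theorem IsOmegaPower.eq_id_of_bijective [Finite A] {φ : FreeGroup A →* FreeGroup A}
    (hφ : Function.Bijective φ) {e : FreePro A →ₜ* FreePro A}
    (he : IsOmegaPower (proExt φ) e) (x : FreePro A) : e x = x := by
  refine eq_id_of_forall_comp_eq e (fun Q _ h => ?_) x
  obtain ⟨n, -, hn⟩ := he.exists_iterate Q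
  -- Each letter is `φ^[n] w` for some `w`, so `k.comp e` determines `k` on letters.
  have hinj : Function.Injective fun k : FreePro A →ₜ* Q => k.comp e := by
    intro k l hkl
    refine FreePro.hom_ext fun a => ?_
    obtain ⟨w, hw⟩ := (hφ.surjective.iterate n) (FreeGroup.of a)
    have := DFunLike.congr_fun hkl (etaHom A w)
    change k (e _) = l (e _) at this
    rwa [hn, hn, iterate_proExt_etaHom, hw] at this
  apply hinj
  change (h.comp e).comp e = h.comp e
  ext y
  exact congrArg h (DFunLike.congr_fun he.2 y)

theorem IsOmegaPower.bijective_of_eq_id [Finite A] {φ : FreeGroup A →* FreeGroup A}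
    {e : FreePro A →ₜ* FreePro A} (he : IsOmegaPower (proExt φ) e)
    (hid : ∀ a : A, e (letter a) = letter a) : Function.Bijective φ := by
  refine bijective_of_forall_finite_quotient φ fun Q _ _ h => ?_
  obtain ⟨n, hn, hn'⟩ := he.exists_iterate (discreteGrp Q)
  have hid' : e = ContinuousMonoidHom.id _ := FreePro.hom_ext hid
  obtain ⟨F, hF⟩ := FreePro.exists_extension (H := discreteGrp Q)
    ((discreteGrpEquiv Q).symm.toMonoidHom.comp h)
  refine ⟨n, hn, fun w => ?_⟩
  have := hn' F (etaHom A w)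
  rw [iterate_proExt_etaHom, hF, hid'] at this
  change F (etaHom A w) = _ at this
  rw [hF] at this
  exact this.symm

/-! ### Bases and numbers of generators -/

theorem closedNormalClosure_eq_bot {P : ProfiniteGrp.{u}} {R : Set P} (hR : R ⊆ {1}) :
    closedNormalClosure R = ⊥ := by
  have h1 : Subgroup.normalClosure R = ⊥ := by
    rw [Subgroup.normalClosure_eq_bot_iff]
    exact hR
  refine SetLike.coe_injective ?_
  rw [closedNormalClosure, h1, Subgroup.topologicalClosure_coe, Subgroup.coe_bot]
  exact isClosed_singleton.closure_eq

theorem nonempty_equiv_quotient_of_subset_one {P : ProfiniteGrp.{u}} {R : Set P} (hR : R ⊆ {1}) :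
    Nonempty (P ≃ₜ* (P ⧸ closedNormalClosure R)) := by
  have hb : Function.Bijective (QuotientGroup.mk' (closedNormalClosure R)) := by
    refine ⟨?_, QuotientGroup.mk'_surjective _⟩
    rw [← MonoidHom.ker_eq_bot_iff, QuotientGroup.ker_mk', closedNormalClosure_eq_bot hR]
  have hh : IsHomeomorph (QuotientGroup.mk' (closedNormalClosure R)) :=
    ⟨QuotientGroup.continuous_mk, QuotientGroup.isOpenMap_coe, hb⟩
  exact ⟨ContinuousMulEquiv.mk' hh.homeomorph fun x y => map_mul (QuotientGroup.mk' _) x y⟩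

theorem minGenerators_le {G : ProfiniteGrp.{u}} {B : Type u} [Finite B] (j : G ≃ₜ* FreePro B) :
    minGenerators G ≤ Nat.card B := by
  obtain ⟨k⟩ := nonempty_equiv_quotient_of_subset_one (P := FreePro B) (Set.empty_subset {1})
  exact iInf_le_of_le B (iInf_le_of_le ‹_› (iInf_le_of_le ∅ (iInf_le_of_le ⟨j.trans k⟩ le_rfl)))

theorem ConvergesToOne.of_finite {X : Type u} [Finite X] {H : ProfiniteGrp.{u}} (f : X → H) :
    ConvergesToOne f := fun _ => Set.toFinite _

/-- The free profinite group on a finite set is free on its letters. -/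
theorem isFreeProfinite_of_equiv [Finite A] {G : ProfiniteGrp.{u}} (j : G ≃ₜ* FreePro A) :
    IsFreeProfinite G := by
  refine ⟨Set.range fun a : A => j.symm (letter a), ConvergesToOne.of_finite _, fun H f _ => ?_⟩
  obtain ⟨F, hF⟩ := FreePro.exists_lift (H := H) fun a : A => f ⟨_, Set.mem_range_self a⟩
  refine ⟨F.comp (j : G →ₜ* FreePro A), ?_, fun K hK => ?_⟩
  · rintro ⟨_, a, rfl⟩
    change F (j (j.symm (letter a))) = _
    rw [j.apply_symm_apply, hF]
  · have : K.comp (j.symm : FreePro A →ₜ* G) = F := FreePro.hom_ext fun a => by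
      rw [hF]
      exact hK ⟨_, a, rfl⟩
    ext x
    rw [← this]
    change K x = K (j.symm (j x))
    rw [j.symm_apply_apply]

/-- A profinite group with a finite basis is isomorphic to the free profinite group on it. -/
theorem IsFreeProfiniteBasis.nonempty_equiv {G : ProfiniteGrp.{u}} {X : Set G} [Finite X]
    (hX : IsFreeProfiniteBasis G X) : Nonempty (G ≃ₜ* FreePro X) := by
  obtain ⟨F, hF, -⟩ := hX.2 (FreePro X) letter (ConvergesToOne.of_finite _)
  obtain ⟨K, hK⟩ := FreePro.exists_lift (H := G) fun x : X => (x : G)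
  have hKF : K.comp F = ContinuousMonoidHom.id G :=
    (hX.2 G _ hX.1).unique (fun x => (congrArg K (hF x)).trans (hK x)) fun _ => rfl
  have hFK : F.comp K = ContinuousMonoidHom.id _ :=
    FreePro.hom_ext fun x => (congrArg F (hK x)).trans (hF x)
  exact ⟨{ toFun := F
           invFun := K
           left_inv := DFunLike.congr_fun hKF
           right_inv := DFunLike.congr_fun hFK
           map_mul' := map_mul F
           continuous_toFun := F.continuous_toFun
           continuous_invFun := K.continuous_toFun }⟩

/-- A basis of a profinite group generated by `A` has at most as many elements as `A`. -/
theorem IsFreeProfiniteBasis.card_le [Finite A] {G : ProfiniteGrp.{u}} {X : Set G}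
    (hX : IsFreeProfiniteBasis G X) (π : FreePro A →ₜ* G) (hπ : Function.Surjective π) :
    Finite X ∧ Nat.card X ≤ Nat.card A := by
  classical
  let C := discreteGrp (ULift.{u} (Multiplicative (ZMod 2)))
  have hC : Nat.card C = 2 := by
    change Nat.card (ULift.{u} (Multiplicative (ZMod 2))) = 2
    simp
  have hinj : Function.Injective fun k : G →ₜ* C => k.comp π := by
    intro k l hkl
    ext g
    obtain ⟨y, rfl⟩ := hπ g
    exact DFunLike.congr_fun hkl y
  -- On an infinite `X` an arbitrary map need not converge to `1`, but maps supported at one point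
  -- do; they embed `X` in the finite set `Hom(F̂(A), C)`.
  have hfin : Finite X := by
    have : Nontrivial C := Finite.one_lt_card_iff_nontrivial.1 (by omega)
    obtain ⟨c, hc⟩ := exists_ne (1 : C)
    have hδ : ∀ x : X, ConvergesToOne (Pi.mulSingle x c : X → C) := by
      refine fun x U => (Set.finite_singleton x).subset fun y hy => ?_
      by_contra hne
      exact hy (by rw [Pi.mulSingle_eq_of_ne hne]; exact one_mem U)
    choose F hF using fun x => (hX.2 C _ (hδ x)).exists
    refine Finite.of_injective (fun x => (F x).comp π) (hinj.comp fun x y hxy => ?_)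
    have h1 := hF x x
    rw [hxy, hF y x, Pi.mulSingle_eq_same] at h1
    by_contra hne
    rw [Pi.mulSingle_eq_of_ne hne] at h1
    exact hc h1.symm
  refine ⟨hfin, ?_⟩
  choose F hF using fun f : X → C => (hX.2 C f (ConvergesToOne.of_finite f)).exists
  -- This gives `2 ^ |X| ≤ 2 ^ |A|`.
  have hF' : Function.Injective fun (f : X → C) (a : A) => F f (π (letter a)) := by
    intro f g hfg
    have : F f = F g := hinj (FreePro.hom_ext fun a => congrFun hfg a)
    funext x
    rw [← hF f x, this, hF g x]
  have := Nat.card_le_card_of_injective _ hF'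
  rw [Nat.card_fun, Nat.card_fun, hC] at this
  exact (Nat.pow_le_pow_iff_right one_lt_two).1 this

/-- Generating systems of minimal cardinality of a free profinite group are free. -/
theorem injective_of_isFreeProfinite [Finite A] {G : ProfiniteGrp.{u}} (hG : IsFreeProfinite G)
    (hA : (Nat.card A : ℕ∞) = minGenerators G) (π : FreePro A →ₜ* G)
    (hπ : Function.Surjective π) : Function.Injective π := by
  obtain ⟨X, hX⟩ := hG
  obtain ⟨_, hle⟩ := hX.card_le π hπ
  obtain ⟨j⟩ := hX.nonempty_equiv
  have hge : Nat.card A ≤ Nat.card X := by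
    have := minGenerators_le j
    rw [← hA] at this
    exact_mod_cast this
  obtain ⟨σ⟩ : Nonempty (A ≃ X) := Finite.card_eq.1 (hge.antisymm hle)
  -- Relabelling the basis by `A` turns `π` into an endomorphism of `F̂(A)`, to which the Hopf
  -- property applies.
  obtain ⟨τ, hτ⟩ := FreePro.exists_lift fun x : X => (letter (σ.symm x) : FreePro A)
  obtain ⟨τ', hτ'⟩ := FreePro.exists_lift fun a : A => (letter (σ a) : FreePro X)
  have hττ' : τ.comp τ' = ContinuousMonoidHom.id _ := FreePro.hom_ext fun a => by
    change τ (τ' (letter a)) = letter a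
    rw [hτ', hτ, σ.symm_apply_apply]
  have hτs : Function.Surjective τ := fun y => ⟨τ' y, DFunLike.congr_fun hττ' y⟩
  have hinj := FreePro.injective_of_surjective ((τ.comp (j : G →ₜ* FreePro X)).comp π)
    ((hτs.comp j.surjective).comp hπ)
  exact fun x y hxy => hinj (congrArg (fun g => τ (j g)) hxy)

end OmegaPresentation

theorem proposition4p2 {A : Type u} [Finite A] (φ : FreeGroup A →* FreeGroup A)
    (G : ProfiniteGrp.{u})
    (hφ : OmegaPresentation.DefinesMinimalOmegaPresentation φ G) :
    OmegaPresentation.IsFreeProfinite G ↔ Function.Bijective φ := by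
  obtain ⟨⟨e, he, ⟨p⟩⟩, hA⟩ := hφ
  constructor
  · intro hG
    refine he.bijective_of_eq_id fun a => ?_
    let N := OmegaPresentation.closedNormalClosure
      (Set.range fun a : A => e (OmegaPresentation.letter a) * (OmegaPresentation.letter a)⁻¹)
    let q : OmegaPresentation.FreePro A →ₜ* (OmegaPresentation.FreePro A ⧸ N) :=
      ⟨QuotientGroup.mk' N, QuotientGroup.continuous_mk⟩
    have hinj := OmegaPresentation.injective_of_isFreeProfinite hG hA
      ((p.symm : (OmegaPresentation.FreePro A ⧸ N) →ₜ* G).comp q) (p.symm.surjective.comp (QuotientGroup.mk'_surjective N))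
    have hmem : e (OmegaPresentation.letter a) * (OmegaPresentation.letter a)⁻¹ ∈ N :=
      Subgroup.le_topologicalClosure _ (Subgroup.subset_normalClosure ⟨a, rfl⟩)
    have hq : q (e (OmegaPresentation.letter a) * (OmegaPresentation.letter a)⁻¹) = 1 :=
      (QuotientGroup.eq_one_iff _).2 hmem
    rw [← mul_inv_eq_one]
    apply hinj
    rw [map_one]
    exact (congrArg p.symm hq).trans (map_one p.symm)
  · intro hb
    obtain ⟨k⟩ := OmegaPresentation.nonempty_equiv_quotient_of_subset_one
      (R := Set.range fun a : A => e (OmegaPresentation.letter a) *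
        (OmegaPresentation.letter a)⁻¹) (by
      rintro _ ⟨a, rfl⟩
      exact mul_inv_eq_one.2 (he.eq_id_of_bijective hb _))
    exact OmegaPresentation.isFreeProfinite_of_equiv (p.trans k.symm)
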